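/- Let $\varkappa \geqslant 1$ be an integer, let $\mathbb T$ be the unit circle in $\mathbb C$, and write $z^\alpha = z_1^{\alpha_1}\cdots z_\varkappa^{\alpha_\varkappa}$ for $z \in \mathbb T^\varkappa$ and $\alpha \in \mathbb Z^\varkappa$. An analytic trigonometric polynomial is a function $q\colon \mathbb T^\varkappa \to \mathbb C$ of the form $q(z) = \sum_{\alpha} b_\alpha z^\alpha$ with finitely many complex coefficients $b_\alpha$ and exponents $\alpha \in \mathbb Z^\varkappa$ whose coordinates are all nonnegative. Let $Y \subset \mathbb T^\varkappa$ be a nonempty set that is determining for analytic trigonometric polynomials, that is, each analytic trigonometric polynomial vanishing on $Y$ vanishes on all of $\mathbb T^\varkappa$. Let $T \subset \mathbb Z^\varkappa$ satisfy $0 \in T = -T$, and let $\{c_\alpha\}_{\alpha \in T}$ be complex numbers. Then the following three conditions are equivalent (where $w \geqslant 0$ for $w \in \mathbb C$ means that $w$ is real and nonnegative): (i) there exists a finite positive Borel measure $\mu$ on $\mathbb T^\varkappa$ such that $c_\alpha = \int_{\mathbb T^\varkappa} z^\alpha \, d\mu(z)$ for all $\alpha \in T$; (ii) $\sum_{\alpha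 \in T} a_\alpha c_\alpha \geqslant 0$ for every system $\{a_\alpha\}_{\alpha \in T}$ of complex numbers with only finitely many nonzero members such that $\sum_{\alpha \in T} a_\alpha z^\alpha \geqslant 0$ for all $z \in \mathbb T^\varkappa$; (iii) $\sum_{\alpha \in T} a_\alpha c_\alpha \geqslant 0$ for every system $\{a_\alpha\}_{\alpha \in T}$ of complex numbers with only finitely many nonzero members for which there exist finitely many analytic trigonometric polynomials $q_1, \ldots, q_k$ such that $\sum_{\alpha \in T} a_\alpha z^\alpha = \sum_{j=1}^k |q_j(z)|^2$ for all $z \in Y$. -/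

import Mathlib

open MeasureTheory
open scoped ComplexOrder Pointwise

noncomputable section

/-- The unit circle carries its Borel σ-algebra. -/
instance Circle.instMeasurableSpaceBorel : MeasurableSpace Circle := borel Circle

instance Circle.instBorelSpaceBorel : BorelSpace Circle := ⟨rfl⟩

/-- The torus `𝕋^κ`, with the product topology and the product (equivalently, Borel) σ-algebra. -/
abbrev Torus (κ : ℕ) : Type := Fin κ → Circle

/-- The function `z ↦ z^α = z₁^{α₁} ⋯ z_κ^{α_κ}` on the torus, for `α ∈ ℤ^κ`. -/
def torusMonomial {κ : ℕ} (α : Fin κ → ℤ) : Torus κ → ℂ :=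
  fun z => ∏ i, (z i : ℂ) ^ α i

/-- The linear space `𝒫_T(𝕋^κ)` of trigonometric polynomials with exponents in `T`: all functions
`z ↦ ∑ a_α z^α` on the torus, where `(a_α)` is finitely supported and vanishes off `T`. -/
def trigPoly {κ : ℕ} (T : Set (Fin κ → ℤ)) : Submodule ℂ (Torus κ → ℂ) :=
  (Finsupp.supported ℂ ℂ T).map (Finsupp.linearCombination ℂ (torusMonomial (κ := κ)))

/-- The analytic trigonometric polynomials, i.e. those with exponents in `ℤ₊^κ`. -/
def analyticTrigPoly (κ : ℕ) : Submodule ℂ (Torus κ → ℂ) :=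
  trigPoly {α : Fin κ → ℤ | ∀ i, 0 ≤ α i}

/-- A nonempty set `Y ⊆ 𝕋^κ` is determining for analytic trigonometric polynomials if each of them
that vanishes on `Y` vanishes on the whole torus. -/
def IsDeterminingAnalytic {κ : ℕ} (Y : Set (Torus κ)) : Prop :=
  Y.Nonempty ∧ ∀ p ∈ analyticTrigPoly κ, (∀ z ∈ Y, p z = 0) → ∀ z, p z = 0

end

/-! The substantial implication is from (iii) to (i). A strictly positive trigonometric polynomial p
on the torus is a sum of squares |q_j|² (`exists_sum_sq_norm_of_pos`): divide the coefficients of p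
by the Fejér multipliers to get g; for large N, g is uniformly close to p, so Re g ≥ 0. The N-th
Fejér mean of g is p itself, and computing that convolution by quadrature at the (2N)-th roots of
unity gives p as a finite combination of translated Fejér kernels with coefficients Re g(w) ≥ 0.
Each kernel is the squared modulus of an analytic polynomial.

Adding ε > 0 and letting ε → 0 carries positivity of the functional to all nonnegative polynomials
with exponents in T. The M. Riesz extension theorem and the Riesz–Markov–Kakutani theorem then
produce the measure (`exists_measure_of_nonneg`). The determining property of Y matters only for
(ii) → (iii), where it spreads the identity from Y to the torus. -/

section Monomials

/-! ### Algebra of trigonometric polynomials and determining sets. -/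

variable {κ : ℕ}

theorem torusMonomial_zero (z : Torus κ) : torusMonomial 0 z = 1 := by
  simp [torusMonomial]

theorem torusMonomial_add (α β : Fin κ → ℤ) (z : Torus κ) :
    torusMonomial (α + β) z = torusMonomial α z * torusMonomial β z := by
  simp only [torusMonomial, Pi.add_apply, ← Finset.prod_mul_distrib]
  exact Finset.prod_congr rfl fun i _ => zpow_add₀ (Circle.coe_ne_zero _) _ _

theorem norm_torusMonomial (α : Fin κ → ℤ) (z : Torus κ) : ‖torusMonomial α z‖ = 1 := by
  simp [torusMonomial, Circle.norm_coe]

theorem torusMonomial_neg (α : Fin κ → ℤ) (z : Torus κ) :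
    torusMonomial (-α) z = star (torusMonomial α z) := by
  simp only [torusMonomial, Pi.neg_apply, zpow_neg, star_prod, star_zpow₀]
  refine Finset.prod_congr rfl fun i _ => ?_
  rw [← inv_zpow, ← Circle.coe_inv, Circle.coe_inv_eq_conj]
  rfl

theorem continuous_torusMonomial (α : Fin κ → ℤ) :
    Continuous (torusMonomial α : Torus κ → ℂ) := by
  unfold torusMonomial
  refine continuous_finsetProd _ fun i _ => ?_
  exact (continuous_subtype_val.comp (continuous_apply i)).zpow₀ _ fun z =>
    Or.inl (Circle.coe_ne_zero _)

theorem integrable_torusMonomial (α : Fin κ → ℤ) (μ : Measure (Torus κ)) [IsFiniteMeasure μ] :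
    Integrable (torusMonomial α) μ :=
  Integrable.of_bound (continuous_torusMonomial α).aestronglyMeasurable 1
    (Filter.Eventually.of_forall fun z => (norm_torusMonomial α z).le)

theorem trigPoly_eq_span (T : Set (Fin κ → ℤ)) :
    trigPoly T = Submodule.span ℂ (torusMonomial '' T) :=
  (Finsupp.span_image_eq_map_linearCombination ℂ T).symm

theorem trigPoly_mono {S T : Set (Fin κ → ℤ)} (h : S ⊆ T) : trigPoly S ≤ trigPoly T := by
  rw [trigPoly_eq_span, trigPoly_eq_span]
  exact Submodule.span_mono (Set.image_mono h)

theorem torusMonomial_mem_trigPoly {T : Set (Fin κ → ℤ)} {α : Fin κ → ℤ} (h : α ∈ T) :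
    torusMonomial α ∈ trigPoly T := by
  rw [trigPoly_eq_span]
  exact Submodule.subset_span ⟨α, h, rfl⟩

theorem mul_mem_trigPoly {S T U : Set (Fin κ → ℤ)} (hU : S + T ⊆ U) {f g : Torus κ → ℂ}
    (hf : f ∈ trigPoly S) (hg : g ∈ trigPoly T) : f * g ∈ trigPoly U := by
  rw [trigPoly_eq_span] at hf hg
  refine Submodule.span_induction₂ (p := fun f g _ _ => f * g ∈ trigPoly U) ?_ ?_ ?_ ?_ ?_ ?_ ?_
    hf hg
  · rintro _ _ ⟨α, hα, rfl⟩ ⟨β, hβ, rfl⟩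
    have : torusMonomial α * torusMonomial β = torusMonomial (α + β) := by
      ext z; simp [torusMonomial_add]
    rw [this]
    exact torusMonomial_mem_trigPoly (hU (Set.add_mem_add hα hβ))
  · intro y _; simp
  · intro y _; simp
  · intro x y z _ _ _ h₁ h₂; rw [add_mul]; exact add_mem h₁ h₂
  · intro x y z _ _ _ h₁ h₂; rw [mul_add]; exact add_mem h₁ h₂
  · intro r x y _ _ h; rw [smul_mul_assoc]; exact Submodule.smul_mem _ _ h
  · intro r x y _ _ h; rw [mul_smul_comm]; exact Submodule.smul_mem _ _ h

theorem star_mem_trigPoly {S T : Set (Fin κ → ℤ)} (hT : -S ⊆ T) {f : Torus κ → ℂ}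
    (hf : f ∈ trigPoly S) : star f ∈ trigPoly T := by
  rw [trigPoly_eq_span] at hf
  refine Submodule.span_induction (p := fun f _ => star f ∈ trigPoly T) ?_ ?_ ?_ ?_ hf
  · rintro _ ⟨α, hα, rfl⟩
    have : star (torusMonomial α : Torus κ → ℂ) = torusMonomial (-α) := by
      ext z; simp [torusMonomial_neg]
    rw [this]
    exact torusMonomial_mem_trigPoly (hT (by simpa using hα))
  · simp
  · intro x y _ _ h₁ h₂; rw [star_add]; exact add_mem h₁ h₂
  · intro r x _ h; rw [star_smul]; exact Submodule.smul_mem _ _ h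

/-- A high enough monomial clears all negative exponents. Monomials never vanish on the torus, so
zeros are unchanged and the determining property extends to all trigonometric polynomials. -/
theorem exists_torusMonomial_mul_mem_analyticTrigPoly {f : Torus κ → ℂ}
    (hf : f ∈ trigPoly Set.univ) :
    ∃ α : Fin κ → ℤ, 0 ≤ α ∧ torusMonomial α * f ∈ analyticTrigPoly κ := by
  have shift : ∀ {f : Torus κ → ℂ} {α β : Fin κ → ℤ}, 0 ≤ β →
      torusMonomial α * f ∈ analyticTrigPoly κ →
      torusMonomial (α + β) * f ∈ analyticTrigPoly κ := by
    intro f α β hβ h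
    have : torusMonomial (α + β) * f = torusMonomial β * (torusMonomial α * f) := by
      ext z; simp [torusMonomial_add]; ring
    rw [this]
    refine mul_mem_trigPoly (S := {α | ∀ i, 0 ≤ α i}) ?_ (torusMonomial_mem_trigPoly hβ) h
    rintro _ ⟨a, ha, b, hb, rfl⟩ i
    exact add_nonneg (ha i) (hb i)
  rw [trigPoly_eq_span] at hf
  refine Submodule.span_induction (p := fun f _ => ∃ α : Fin κ → ℤ, 0 ≤ α ∧
    torusMonomial α * f ∈ analyticTrigPoly κ) ?_ ?_ ?_ ?_ hf
  · rintro _ ⟨β, -, rfl⟩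
    refine ⟨fun i => |β i|, fun i => abs_nonneg _, ?_⟩
    have : torusMonomial (fun i => |β i|) * torusMonomial β =
        torusMonomial ((fun i => |β i|) + β) := by
      ext z; simp [torusMonomial_add]
    rw [this]
    refine torusMonomial_mem_trigPoly fun i => ?_
    have := neg_abs_le (β i)
    simp only [Pi.add_apply]
    linarith
  · exact ⟨0, le_rfl, by simp⟩
  · rintro f g _ _ ⟨α, hα, hf⟩ ⟨β, hβ, hg⟩
    refine ⟨α + β, add_nonneg hα hβ, ?_⟩
    rw [mul_add]
    refine add_mem (shift hβ hf) ?_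
    rw [add_comm α β]
    exact shift hα hg
  · rintro r f _ ⟨α, hα, hf⟩
    refine ⟨α, hα, ?_⟩
    rw [mul_smul_comm]
    exact Submodule.smul_mem _ _ hf

theorem IsDeterminingAnalytic.eq_zero_of_mem_trigPoly {Y : Set (Torus κ)}
    (hY : IsDeterminingAnalytic Y) {f : Torus κ → ℂ} (hf : f ∈ trigPoly Set.univ)
    (h : ∀ z ∈ Y, f z = 0) (z : Torus κ) : f z = 0 := by
  obtain ⟨α, -, hα⟩ := exists_torusMonomial_mul_mem_analyticTrigPoly hf
  have := hY.2 _ hα (fun z hz => by simp [h z hz]) z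
  have hne : torusMonomial α z ≠ 0 := by
    rw [← norm_ne_zero_iff, norm_torusMonomial]; exact one_ne_zero
  simpa [hne] using this

theorem finsuppSum_torusMonomial_mem_trigPoly {T : Set (Fin κ → ℤ)} (a : T →₀ ℂ) :
    (fun z => a.sum fun α b => b * torusMonomial (α : Fin κ → ℤ) z) ∈ trigPoly T := by
  have : (fun z => a.sum fun α b => b * torusMonomial (α : Fin κ → ℤ) z) =
      ∑ α ∈ a.support, a α • torusMonomial (α : Fin κ → ℤ) := by
    ext z; simp [Finsupp.sum]
  rw [this]
  exact sum_mem fun α _ => Submodule.smul_mem _ _ (torusMonomial_mem_trigPoly α.2)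

theorem sum_sq_norm_mem_trigPoly {k : ℕ} {q : Fin k → Torus κ → ℂ}
    (hq : ∀ j, q j ∈ analyticTrigPoly κ) :
    (fun z => ∑ j, ((‖q j z‖ ^ 2 : ℝ) : ℂ)) ∈ trigPoly (κ := κ) Set.univ := by
  have : (fun z => ∑ j, ((‖q j z‖ ^ 2 : ℝ) : ℂ)) = ∑ j, q j * star (q j) := by
    ext z
    simp [Complex.mul_conj']
  rw [this]
  exact sum_mem fun j _ => mul_mem_trigPoly (Set.subset_univ _) (hq j)
    (star_mem_trigPoly (Set.subset_univ _) (hq j))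

/-- On the torus |q|² = q · conj q is again a trigonometric polynomial, so the difference of the two
sides is one that vanishes on Y. -/
theorem IsDeterminingAnalytic.eq_sum_sq_norm {Y : Set (Torus κ)}
    (hY : IsDeterminingAnalytic Y) {f : Torus κ → ℂ} (hf : f ∈ trigPoly Set.univ) {k : ℕ}
    {q : Fin k → Torus κ → ℂ} (hq : ∀ j, q j ∈ analyticTrigPoly κ)
    (h : ∀ z ∈ Y, f z = ∑ j, ((‖q j z‖ ^ 2 : ℝ) : ℂ)) (z : Torus κ) :
    f z = ∑ j, ((‖q j z‖ ^ 2 : ℝ) : ℂ) := by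
  rw [← sub_eq_zero]
  exact hY.eq_zero_of_mem_trigPoly (sub_mem hf (sum_sq_norm_mem_trigPoly hq))
    (fun z hz => sub_eq_zero.2 (h z hz)) z

theorem finsuppSum_nonneg_of_moments {T : Set (Fin κ → ℤ)} {c : T → ℂ} (μ : Measure (Torus κ))
    [IsFiniteMeasure μ] (hc : ∀ α : T, c α = ∫ z, torusMonomial (α : Fin κ → ℤ) z ∂μ)
    (a : T →₀ ℂ)
    (ha : ∀ z : Torus κ, 0 ≤ a.sum fun α b => b * torusMonomial (α : Fin κ → ℤ) z) :
    0 ≤ a.sum fun α b => b * c α := by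
  have : (a.sum fun α b => b * c α) =
      ∫ z, (a.sum fun α b => b * torusMonomial (α : Fin κ → ℤ) z) ∂μ := by
    simp only [Finsupp.sum]
    rw [integral_finsetSum _ fun α _ => (integrable_torusMonomial _ μ).const_mul _]
    exact Finset.sum_congr rfl fun α _ => by rw [integral_const_mul, hc]
  rw [this]
  exact integral_nonneg ha

end Monomials

/-! ### Positive functionals as integrals. -/

section RieszExtension

open scoped CompactlySupported

/-- A linear functional `B` which is nonnegative on all `v` with `A v ≥ 0` for a linear map `A` into
the continuous functions on a compact space whose range contains `1` is an integral. -/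
theorem exists_measure_of_nonneg_of_nonneg {X V : Type*} [TopologicalSpace X] [T2Space X]
    [CompactSpace X] [MeasurableSpace X] [BorelSpace X] [AddCommGroup V] [Module ℝ V]
    (A : V →ₗ[ℝ] C_c(X, ℝ)) (B : V →ₗ[ℝ] ℝ) (e : V) (he : ∀ x, A e x = 1)
    (h : ∀ v, (∀ x, 0 ≤ A v x) → 0 ≤ B v) :
    ∃ μ : Measure X, IsFiniteMeasure μ ∧ ∀ v, B v = ∫ x, A v x ∂μ := by
  have hker : LinearMap.ker A ≤ LinearMap.ker B := by
    intro v hv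
    rw [LinearMap.mem_ker] at hv ⊢
    refine le_antisymm ?_ (h v fun x => by simp [hv])
    have := h (-v) fun x => by simp [hv]
    simpa using this
  let f : C_c(X, ℝ) →ₗ.[ℝ] ℝ :=
    ⟨LinearMap.range A, (LinearMap.ker A).liftQ B hker ∘ₗ A.quotKerEquivRange.symm.toLinearMap⟩
  have hf : ∀ v (hv : A v ∈ f.domain), f ⟨A v, hv⟩ = B v := by
    intro v hv
    change (LinearMap.ker A).liftQ B hker (A.quotKerEquivRange.symm ⟨A v, hv⟩) = B v
    rw [LinearMap.quotKerEquivRange_symm_apply_image]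
    simp
  have : PosSMulMono ℝ C_c(X, ℝ) :=
    ⟨fun r hr g₁ g₂ hg x => mul_le_mul_of_nonneg_left (hg x) hr⟩
  have nonneg_iff : ∀ g : C_c(X, ℝ), g ∈ PointedCone.positive ℝ C_c(X, ℝ) ↔ ∀ x, 0 ≤ g x := by
    intro g
    rw [PointedCone.mem_positive]
    rfl
  obtain ⟨g, hg, hg0⟩ := riesz_extension (PointedCone.positive ℝ C_c(X, ℝ)) f
    (by
      rintro ⟨_, v, rfl⟩ hv
      exact (h v ((nonneg_iff _).1 hv)).trans_eq (hf v ⟨v, rfl⟩).symm)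
    (by
      -- Cofinality hypothesis of the extension theorem: y is bounded below by a constant C, and the
      -- range of `A` contains the constant -C.
      intro y
      obtain ⟨C, hC⟩ := (isCompact_range y.continuous).bddBelow
      refine ⟨⟨A (-C • e), _, rfl⟩, (nonneg_iff _).2 fun x => ?_⟩
      have : C ≤ y x := hC ⟨x, rfl⟩
      simp [he]
      linarith)
  let Λ : C_c(X, ℝ) →ₚ[ℝ] ℝ :=
    PositiveLinearMap.mk₀ g fun x hx => hg0 x ((PointedCone.mem_positive ℝ _).2 hx)
  refine ⟨RealRMK.rieszMeasure Λ, inferInstance, fun v => ?_⟩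
  rw [RealRMK.integral_rieszMeasure, ← hf v ⟨v, rfl⟩, ← hg]
  rfl

end RieszExtension

/-! ### From positivity on nonnegative polynomials to a measure. -/

section Moments

open scoped CompactlySupported

variable {κ : ℕ} {T : Set (Fin κ → ℤ)}

/-- The trigonometric polynomial with coefficients `a`, as a linear function of `a`. -/
noncomputable def finsuppTrigPoly (T : Set (Fin κ → ℤ)) (z : Torus κ) : (T →₀ ℂ) →ₗ[ℂ] ℂ :=
  Finsupp.linearCombination ℂ fun α : T => torusMonomial (α : Fin κ → ℤ) z

theorem finsuppTrigPoly_apply (a : T →₀ ℂ) (z : Torus κ) :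
    finsuppTrigPoly T z a = a.sum fun α b => b * torusMonomial (α : Fin κ → ℤ) z :=
  rfl

theorem finsuppTrigPoly_single (α : T) (b : ℂ) (z : Torus κ) :
    finsuppTrigPoly T z (Finsupp.single α b) = b * torusMonomial (α : Fin κ → ℤ) z := by
  simp [finsuppTrigPoly]

theorem continuous_finsuppTrigPoly (a : T →₀ ℂ) :
    Continuous fun z => finsuppTrigPoly T z a := by
  simp only [finsuppTrigPoly_apply, Finsupp.sum]
  exact continuous_finsetSum _ fun α _ => continuous_const.mul (continuous_torusMonomial _)

/-- The real part of the trigonometric polynomial with coefficients `a`, as a real linear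
function of `a`. -/
noncomputable def reTrigPoly (T : Set (Fin κ → ℤ)) : (T →₀ ℂ) →ₗ[ℝ] C_c(Torus κ, ℝ) where
  toFun a :=
    { toFun := fun z => (finsuppTrigPoly T z a).re
      continuous_toFun := Complex.continuous_re.comp (continuous_finsuppTrigPoly a)
      hasCompactSupport' := HasCompactSupport.of_compactSpace _ }
  map_add' a b := by ext z; simp
  map_smul' r a := by
    ext z
    have : r • a = (r : ℂ) • a := by ext α; rfl
    change (finsuppTrigPoly T z (r • a)).re = r * (finsuppTrigPoly T z a).re
    rw [this, map_smul, smul_eq_mul, Complex.re_ofReal_mul]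

theorem reTrigPoly_apply (a : T →₀ ℂ) (z : Torus κ) :
    reTrigPoly T a z = (finsuppTrigPoly T z a).re :=
  rfl

theorem neg_mem_of_eq_neg (hT : T = -T) (α : T) : -(α : Fin κ → ℤ) ∈ T := by
  have h : (α : Fin κ → ℤ) ∈ -T := hT ▸ α.2
  exact h

/-- Coefficients of the complex conjugate of the trigonometric polynomial with coefficients `a`. -/
noncomputable def conjCoeff (hT : T = -T) (a : T →₀ ℂ) : T →₀ ℂ :=
  a.sum fun α b => Finsupp.single ⟨-(α : Fin κ → ℤ), neg_mem_of_eq_neg hT α⟩ (star b)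

theorem linearCombination_conjCoeff (hT : T = -T) {c : T → ℂ}
    (hc : ∀ α : T, c ⟨-(α : Fin κ → ℤ), neg_mem_of_eq_neg hT α⟩ = star (c α)) (a : T →₀ ℂ) :
    Finsupp.linearCombination ℂ c (conjCoeff hT a) = star (Finsupp.linearCombination ℂ c a) := by
  rw [conjCoeff, map_finsuppSum, Finsupp.linearCombination_apply]
  simp [Finsupp.sum, star_sum, hc]

/-- Tested on 2 + 2 Re(b z^α) ≥ 0 with |b| = 1: vanishing of the imaginary part gives Im c_{-α} =
-Im c_α for b = 1 and Re c_{-α} = Re c_α for b = i. -/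
theorem star_eq_of_nonneg (hT0 : (0 : Fin κ → ℤ) ∈ T) (hT : T = -T) {c : T → ℂ}
    (h : ∀ a : T →₀ ℂ, (∀ z : Torus κ, 0 ≤ finsuppTrigPoly T z a) →
      0 ≤ Finsupp.linearCombination ℂ c a) (α : T) :
    c ⟨-(α : Fin κ → ℤ), neg_mem_of_eq_neg hT α⟩ = star (c α) := by
  have h0 : 0 ≤ c ⟨0, hT0⟩ := by
    have := h (Finsupp.single ⟨0, hT0⟩ 1) fun z => by
      simp [finsuppTrigPoly_single, torusMonomial_zero]
    simpa using this
  have key : ∀ b : ℂ, ‖b‖ = 1 →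
      0 ≤ 2 * c ⟨0, hT0⟩ + (b * c α + star b * c ⟨-(α : Fin κ → ℤ), neg_mem_of_eq_neg hT α⟩) := by
    intro b hb
    have := h (Finsupp.single ⟨0, hT0⟩ 2 + (Finsupp.single α b +
      Finsupp.single ⟨-(α : Fin κ → ℤ), neg_mem_of_eq_neg hT α⟩ (star b))) fun z => by
        simp only [map_add, finsuppTrigPoly_single, torusMonomial_zero, torusMonomial_neg,
          ← star_mul']
        have hre : -1 ≤ (b * torusMonomial (α : Fin κ → ℤ) z).re := by
          have := (abs_le.1 (Complex.abs_re_le_norm (b * torusMonomial (α : Fin κ → ℤ) z))).1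
          rwa [norm_mul, hb, norm_torusMonomial, mul_one] at this
        rw [Complex.star_def, Complex.add_conj, Complex.nonneg_iff]
        constructor
        · simp only [mul_one, Complex.add_re, Complex.ofReal_re, Complex.re_ofNat]
          linarith
        · simp
    simpa using this
  have h1 := (Complex.nonneg_iff.1 (key 1 (by simp))).2
  have h2 := (Complex.nonneg_iff.1 (key Complex.I (by simp))).2
  have h3 := (Complex.nonneg_iff.1 h0).2
  simp [← h3] at h1 h2
  apply Complex.ext
  · simp; linarith
  · simp; linarith

/-- The representation theorem is real, so it is applied to real parts; the symmetry of `c` makes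
the real part of the functional depend only on the real part of the polynomial. -/
theorem exists_measure_of_nonneg (hT0 : (0 : Fin κ → ℤ) ∈ T) (hT : T = -T) {c : T → ℂ}
    (h : ∀ a : T →₀ ℂ, (∀ z : Torus κ, 0 ≤ finsuppTrigPoly T z a) →
      0 ≤ Finsupp.linearCombination ℂ c a) :
    ∃ μ : Measure (Torus κ), IsFiniteMeasure μ ∧
      ∀ α : T, c α = ∫ z, torusMonomial (α : Fin κ → ℤ) z ∂μ := by
  have hc := star_eq_of_nonneg hT0 hT h
  let B : (T →₀ ℂ) →ₗ[ℝ] ℝ :=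
    Complex.reLm ∘ₗ (Finsupp.linearCombination ℂ c).restrictScalars ℝ
  have hB : ∀ a, B a = (Finsupp.linearCombination ℂ c a).re := fun a => rfl
  obtain ⟨μ, hμ, hint⟩ := exists_measure_of_nonneg_of_nonneg (reTrigPoly T) B
    (Finsupp.single ⟨0, hT0⟩ 1)
    (fun z => by simp [reTrigPoly_apply, finsuppTrigPoly_single, torusMonomial_zero])
    (fun a ha => by
      -- This polynomial takes the values 2 Re p(z), and the functional takes it to 2 `B a`.
      have h2 := h (a + conjCoeff hT a) fun z => by
        rw [map_add, finsuppTrigPoly, linearCombination_conjCoeff hT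
          (fun α => torusMonomial_neg _ _), Complex.star_def, Complex.add_conj,
          Complex.nonneg_iff]
        have := ha z
        rw [reTrigPoly_apply, finsuppTrigPoly] at this
        exact ⟨by simpa using this, by simp⟩
      rw [map_add, linearCombination_conjCoeff hT hc, Complex.star_def, Complex.add_conj] at h2
      have h3 := (Complex.nonneg_iff.1 h2).1
      rw [Complex.ofReal_re] at h3
      rw [hB]
      linarith)
  refine ⟨μ, hμ, fun α => ?_⟩
  have hre := hint (Finsupp.single α 1)
  -- Re(-i w) = Im w, so this test vector yields the imaginary part of the moment.
  have him := hint (Finsupp.single α (-Complex.I))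
  simp only [hB, reTrigPoly_apply, finsuppTrigPoly_single] at hre him
  have hi := integrable_torusMonomial (α : Fin κ → ℤ) μ
  apply Complex.ext
  · rw [← RCLike.re_eq_complex_re, ← integral_re hi]
    simpa using hre
  · rw [← RCLike.im_eq_complex_im, ← integral_im hi]
    simpa using him

end Moments

/-! ### Fejér kernels, exact quadrature and sums of squares. -/

section Fejer

open Finset Filter Topology

/-- This count is the a-th coefficient of the Fejér kernel |∑_{n < N} u^n|². The truncated
subtraction correctly gives 0 once |a| ≥ N. -/
theorem card_filter_sub_eq (N : ℕ) (a : ℤ) :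
    #{p ∈ range N ×ˢ range N | (p.1 : ℤ) - p.2 = a} = N - a.natAbs := by
  conv_rhs => rw [← card_range (N - a.natAbs)]
  -- A pair with difference a is determined by its minimum t: it is (t + a⁺, t + a⁻).
  refine card_nbij' (fun p => min p.1 p.2) (fun t => (t + a.toNat, t + (-a).toNat)) ?_ ?_ ?_ ?_
  · rintro ⟨m, n⟩ h
    simp only [coe_filter, mem_product, mem_range, Set.mem_ofPred_eq, coe_range, Set.mem_Iio] at h ⊢
    omega
  · intro t h
    simp only [coe_filter, mem_product, mem_range, Set.mem_ofPred_eq, coe_range, Set.mem_Iio] at h ⊢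
    omega
  · rintro ⟨m, n⟩ h
    simp only [coe_filter, mem_product, mem_range, Set.mem_ofPred_eq] at h
    simp only [Prod.mk.injEq]
    omega
  · intro t h
    simp only
    omega

theorem IsPrimitiveRoot.sum_range_zpow_pow {ζ : ℂ} {M : ℕ} (hζ : IsPrimitiveRoot ζ M) {b : ℤ}
    (hb : b.natAbs < M) : ∑ j ∈ range M, (ζ ^ b) ^ j = if b = 0 then (M : ℂ) else 0 := by
  split_ifs with h
  · simp [h]
  · have h1 : ζ ^ b - 1 ≠ 0 := by
      rw [sub_ne_zero, Ne, hζ.zpow_eq_one_iff_dvd]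
      intro hd
      exact h (Int.eq_zero_of_dvd_of_natAbs_lt_natAbs hd (by simpa using hb))
    have h2 : (ζ ^ b) ^ M = 1 := by
      rw [← zpow_natCast, ← zpow_mul, mul_comm, zpow_mul, zpow_natCast, hζ.pow_eq_one, one_zpow]
    have := mul_geom_sum (ζ ^ b) M
    rw [h2, sub_self] at this
    exact (mul_eq_zero.1 this).resolve_left h1

/-- The Dirichlet type kernel `∑_{n < N} u^n`. -/
noncomputable def circleGeomSum (N : ℕ) (u : Circle) : ℂ :=
  ∑ n ∈ range N, (u : ℂ) ^ n

theorem circleGeomSum_mul_star (N : ℕ) (u : Circle) :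
    circleGeomSum N u * star (circleGeomSum N u) =
      ∑ p ∈ range N ×ˢ range N, (u : ℂ) ^ ((p.1 : ℤ) - p.2) := by
  rw [circleGeomSum, star_sum, sum_mul_sum, sum_product]
  refine sum_congr rfl fun m _ => sum_congr rfl fun n _ => ?_
  rw [zpow_sub₀ (Circle.coe_ne_zero u), zpow_natCast, zpow_natCast, star_pow, Complex.star_def,
    ← Circle.coe_inv_eq_conj, Circle.coe_inv, inv_pow, div_eq_mul_inv]

/-- Convolution with the Fejér kernel multiplies z^a by N - |a|. Since |a| < N and |m - n| < N, the
frequency a - (m - n) is less than 2N in absolute value, so 2N nodes integrate without aliasing. -/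
theorem sum_zpow_mul_circleGeomSum {ζ : Circle} {N : ℕ}
    (hζ : IsPrimitiveRoot (ζ : ℂ) (2 * N)) {a : ℤ} (ha : a.natAbs < N) (z : Circle) :
    ∑ j ∈ range (2 * N), ((ζ ^ j : Circle) : ℂ) ^ a *
      (circleGeomSum N (z / ζ ^ j) * star (circleGeomSum N (z / ζ ^ j))) =
      (2 * N : ℕ) * (N - a.natAbs : ℕ) * (z : ℂ) ^ a := by
  have hz : (ζ : ℂ) ≠ 0 := Circle.coe_ne_zero ζ
  calc
    _ = ∑ j ∈ range (2 * N), ∑ p ∈ range N ×ˢ range N,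
          (z : ℂ) ^ ((p.1 : ℤ) - p.2) * ((ζ : ℂ) ^ (a - ((p.1 : ℤ) - p.2))) ^ j := by
      refine sum_congr rfl fun j _ => ?_
      rw [circleGeomSum_mul_star, mul_sum]
      refine sum_congr rfl fun p _ => ?_
      rw [Circle.coe_div, div_zpow, Circle.coe_pow, zpow_sub₀ hz a, div_pow, ← zpow_natCast,
        ← zpow_natCast, ← zpow_natCast, ← zpow_mul, ← zpow_mul, ← zpow_mul, ← zpow_mul,
        mul_comm (j : ℤ), mul_comm (j : ℤ)]
      ring
    _ = ∑ p ∈ range N ×ˢ range N, if (p.1 : ℤ) - p.2 = a then (2 * N : ℕ) * (z : ℂ) ^ a else 0 := by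
      rw [sum_comm]
      refine sum_congr rfl fun p hp => ?_
      simp only [mem_product, mem_range] at hp
      rw [← mul_sum, hζ.sum_range_zpow_pow (by omega)]
      by_cases h : (p.1 : ℤ) - p.2 = a
      · rw [if_pos (by omega), if_pos h, h, mul_comm]
      · rw [if_neg (by omega), if_neg h, mul_zero]
    _ = _ := by
      rw [← sum_filter, sum_const, card_filter_sub_eq, nsmul_eq_mul]
      ring

variable {κ : ℕ}

/-- The product kernel `∏ i, ∑_{n < N} (z i / w i)^n`. -/
noncomputable def torusGeomSum (N : ℕ) (w z : Torus κ) : ℂ :=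
  ∏ i, circleGeomSum N (z i / w i)

theorem torusGeomSum_mem_analyticTrigPoly (N : ℕ) (w : Torus κ) :
    torusGeomSum N w ∈ analyticTrigPoly κ := by
  have : torusGeomSum N w = ∏ i, fun z : Torus κ => circleGeomSum N (z i / w i) := by
    ext z; simp [torusGeomSum]
  rw [this]
  refine prod_induction _ (· ∈ analyticTrigPoly κ) (fun f g hf hg => ?_) ?_ fun i _ => ?_
  · refine mul_mem_trigPoly ?_ hf hg
    rintro _ ⟨a, ha, b, hb, rfl⟩ i
    exact add_nonneg (ha i) (hb i)
  · have : (1 : Torus κ → ℂ) = torusMonomial 0 := by ext z; simp [torusMonomial_zero]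
    rw [this]
    exact torusMonomial_mem_trigPoly fun i => le_rfl
  · have : (fun z : Torus κ => circleGeomSum N (z i / w i)) =
        ∑ n ∈ range N, ((w i : ℂ) ^ n)⁻¹ • torusMonomial (Pi.single i (n : ℤ)) := by
      ext z
      simp only [circleGeomSum, Finset.sum_apply, Pi.smul_apply, smul_eq_mul]
      refine sum_congr rfl fun n _ => ?_
      have h : torusMonomial (Pi.single i (n : ℤ)) z = (z i : ℂ) ^ n := by
        rw [torusMonomial, prod_eq_single i (fun j _ hj => by simp [hj]) (by simp)]
        simp
      rw [h, Circle.coe_div, div_pow, div_eq_inv_mul]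
    rw [this]
    refine sum_mem fun n _ => Submodule.smul_mem _ _ (torusMonomial_mem_trigPoly fun j => ?_)
    by_cases h : j = i
    · subst h; simp
    · simp [h]

theorem sum_torusMonomial_mul_torusGeomSum {ζ : Circle} {N : ℕ}
    (hζ : IsPrimitiveRoot (ζ : ℂ) (2 * N)) {α : Fin κ → ℤ} (hα : ∀ i, (α i).natAbs < N)
    (z : Torus κ) :
    ∑ j ∈ Fintype.piFinset fun _ : Fin κ => range (2 * N),
      torusMonomial α (fun i => ζ ^ j i) * ((‖torusGeomSum N (fun i => ζ ^ j i) z‖ ^ 2 : ℝ) : ℂ) =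
      ((2 * N : ℕ) : ℂ) ^ κ * (∏ i, ((N - (α i).natAbs : ℕ) : ℂ)) * torusMonomial α z := by
  have h := prod_univ_sum (fun _ : Fin κ => range (2 * N)) fun i j =>
    ((ζ ^ j : Circle) : ℂ) ^ α i *
      (circleGeomSum N (z i / ζ ^ j) * star (circleGeomSum N (z i / ζ ^ j)))
  simp only [sum_zpow_mul_circleGeomSum hζ (hα _)] at h
  rw [prod_mul_distrib, prod_mul_distrib, prod_const, card_univ, Fintype.card_fin] at h
  rw [torusMonomial, h]
  refine sum_congr rfl fun j _ => ?_
  rw [prod_mul_distrib, prod_mul_distrib, ← star_prod, Complex.ofReal_pow, ← Complex.mul_conj']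
  rfl

/-- Correcting the coefficients by the inverse normalised Fejér multipliers is asymptotically
harmless. -/
theorem tendsto_prod_natCast_div_sub (α : Fin κ → ℤ) :
    Tendsto (fun N : ℕ => (N : ℂ) ^ κ / ∏ i, ((N - (α i).natAbs : ℕ) : ℂ)) atTop (𝓝 1) := by
  have h : Tendsto (fun N : ℕ => ∏ i, (N : ℂ) / (N + -((α i).natAbs : ℂ))) atTop
      (𝓝 (∏ _i : Fin κ, (1 : ℂ))) :=
    tendsto_finsetProd _ fun i _ => tendsto_natCast_div_add_atTop _
  rw [prod_const_one] at h
  refine h.congr' ?_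
  have : ∀ᶠ N : ℕ in atTop, ∀ i, (α i).natAbs ≤ N :=
    eventually_all.2 fun i => eventually_ge_atTop _
  filter_upwards [this] with N hN
  rw [prod_div_distrib, prod_const, card_univ, Fintype.card_fin]
  congr 1
  refine prod_congr rfl fun i _ => ?_
  rw [Nat.cast_sub (hN i), sub_eq_add_neg]

/-- A strictly positive trigonometric polynomial on the torus is a sum of squared absolute values
of analytic trigonometric polynomials. -/
theorem exists_sum_sq_norm_of_pos {T : Set (Fin κ → ℤ)} (a : T →₀ ℂ)
    (ha : ∀ z, 0 < finsuppTrigPoly T z a) :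
    ∃ (k : ℕ) (q : Fin k → Torus κ → ℂ), (∀ j, q j ∈ analyticTrigPoly κ) ∧
      ∀ z, finsuppTrigPoly T z a = ∑ j, ((‖q j z‖ ^ 2 : ℝ) : ℂ) := by
  obtain ⟨z₀, -, hz₀⟩ := isCompact_univ.exists_isMinOn (Set.univ_nonempty (α := Torus κ))
    (Complex.continuous_re.comp (continuous_finsuppTrigPoly a)).continuousOn
  set δ := (finsuppTrigPoly T z₀ a).re with hδ
  have hδ0 : 0 < δ := (Complex.pos_iff.1 (ha z₀)).1
  have hle : ∀ z, δ ≤ (finsuppTrigPoly T z a).re := fun z => hz₀ (Set.mem_univ z)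
  let r : ℕ → T → ℂ := fun N α => (N : ℂ) ^ κ / ∏ i, ((N - ((α : Fin κ → ℤ) i).natAbs : ℕ) : ℂ)
  have hlim : Tendsto (fun N => ∑ α ∈ a.support, ‖a α‖ * ‖r N α - 1‖) atTop (𝓝 0) := by
    have : Tendsto (fun N => ∑ α ∈ a.support, ‖a α‖ * ‖r N α - 1‖) atTop
        (𝓝 (∑ α ∈ a.support, ‖a α‖ * ‖(1 : ℂ) - 1‖)) :=
      tendsto_finsetSum _ fun α _ =>
        (((tendsto_prod_natCast_div_sub (α : Fin κ → ℤ)).sub_const 1).norm).const_mul _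
    simpa using this
  have hev : ∀ᶠ N : ℕ in atTop, ∀ α ∈ a.support, ∀ i, ((α : Fin κ → ℤ) i).natAbs < N :=
    (eventually_all_finset _).2 fun α _ => eventually_all.2 fun i => eventually_gt_atTop _
  obtain ⟨N, hNδ, hNα, hN0⟩ :=
    ((hlim.eventually_lt_const hδ0).and (hev.and (eventually_gt_atTop 0))).exists
  -- Precompensated polynomial, whose Fejér mean is exactly the given one; by the choice of N it is
  -- within the minimum δ of it, hence Re g ≥ 0.
  let g : Torus κ → ℂ := fun w => ∑ α ∈ a.support, a α * r N α * torusMonomial (α : Fin κ → ℤ) w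
  have hg : ∀ w, 0 ≤ (g w).re := by
    intro w
    have h1 : ‖g w - finsuppTrigPoly T w a‖ < δ := by
      refine lt_of_le_of_lt ?_ hNδ
      rw [finsuppTrigPoly_apply, Finsupp.sum, ← sum_sub_distrib]
      refine (norm_sum_le _ _).trans (sum_le_sum fun α _ => le_of_eq ?_)
      have : a α * r N α * torusMonomial (α : Fin κ → ℤ) w -
          a α * torusMonomial (α : Fin κ → ℤ) w =
          a α * (r N α - 1) * torusMonomial (α : Fin κ → ℤ) w := by ring
      rw [this, norm_mul, norm_mul, norm_torusMonomial, mul_one]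
    have h2 := (abs_le.1 (Complex.abs_re_le_norm (g w - finsuppTrigPoly T w a))).1
    rw [Complex.sub_re] at h2
    linarith [hle w]
  let ζ : Circle := Circle.exp (2 * Real.pi / (2 * N : ℕ))
  have hζ : IsPrimitiveRoot (ζ : ℂ) (2 * N) := by
    have := Complex.isPrimitiveRoot_exp (2 * N) (by omega)
    convert this using 1
    rw [Circle.coe_exp]
    congr 1
    push_cast
    ring
  -- (2N)^κ comes from the number of nodes; N^κ is what remains of the multiplier ∏ (N - |α_i|)
  -- after the factor `r N α`.
  let C : ℝ := ((2 * N : ℕ) : ℝ) ^ κ * (N : ℝ) ^ κ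
  have hC : 0 < C := by positivity
  let J := Fintype.piFinset fun _ : Fin κ => range (2 * N)
  let w : (Fin κ → ℕ) → Torus κ := fun j i => ζ ^ j i
  have key : ∀ z, (C : ℂ) * finsuppTrigPoly T z a =
      ∑ j ∈ J, g (w j) * ((‖torusGeomSum N (w j) z‖ ^ 2 : ℝ) : ℂ) := by
    intro z
    simp only [g, sum_mul]
    rw [sum_comm, finsuppTrigPoly_apply, Finsupp.sum, mul_sum]
    refine sum_congr rfl fun α hα => ?_
    have h := sum_torusMonomial_mul_torusGeomSum hζ (hNα α hα) z
    simp only [mul_assoc (a α * r N α)]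
    rw [← mul_sum, h]
    have hne : ∏ i, ((N - ((α : Fin κ → ℤ) i).natAbs : ℕ) : ℂ) ≠ 0 :=
      prod_ne_zero_iff.2 fun i _ => Nat.cast_ne_zero.2 (Nat.sub_pos_of_lt (hNα α hα i)).ne'
    simp only [r, C]
    push_cast
    field_simp
  -- The left side and the kernels are real, so real parts may be taken: only Re g enters, and its
  -- square root is absorbed into the analytic factor.
  have key' : ∀ z, finsuppTrigPoly T z a =
      ∑ j ∈ J, ((‖((Real.sqrt ((g (w j)).re / C) : ℝ) : ℂ) * torusGeomSum N (w j) z‖ ^ 2 : ℝ) : ℂ) := by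
    intro z
    have h1 : (finsuppTrigPoly T z a) = ((finsuppTrigPoly T z a).re : ℂ) :=
      Complex.ext rfl (by simpa using (Complex.pos_iff.1 (ha z)).2.symm)
    rw [h1, ← Complex.ofReal_sum]
    congr 1
    have h2 := congrArg Complex.re (key z)
    rw [Complex.re_ofReal_mul, Complex.re_sum] at h2
    rw [← mul_right_inj' hC.ne', h2, mul_sum]
    refine sum_congr rfl fun j _ => ?_
    rw [Complex.re_mul_ofReal, norm_mul, mul_pow, Complex.norm_real, Real.norm_eq_abs, sq_abs,
      Real.sq_sqrt (div_nonneg (hg _) hC.le)]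
    field_simp
  refine ⟨#J, fun j z => ((Real.sqrt ((g (w (J.equivFin.symm j))).re / C) : ℝ) : ℂ) *
    torusGeomSum N (w (J.equivFin.symm j)) z, fun j => ?_, fun z => ?_⟩
  · exact Submodule.smul_mem _ _ (torusGeomSum_mem_analyticTrigPoly N _)
  · rw [key', ← sum_coe_sort]
    exact (Equiv.sum_comp J.equivFin.symm fun j : J =>
      ((‖((Real.sqrt ((g (w j)).re / C) : ℝ) : ℂ) * torusGeomSum N (w j) z‖ ^ 2 : ℝ) : ℂ)).symm

end Fejer

/-! ### Limit argument and the equivalence. -/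

theorem nonneg_of_forall_pos_mul_add_nonneg {u v : ℂ}
    (h : ∀ ε : ℝ, 0 < ε → 0 ≤ v + (ε : ℂ) * u) : 0 ≤ v := by
  have hcont : Continuous fun ε : ℝ => v + (ε : ℂ) * u := by fun_prop
  have hlim : Filter.Tendsto (fun ε : ℝ => v + (ε : ℂ) * u) (nhdsWithin 0 (Set.Ioi 0))
      (nhds v) := by
    have := (hcont.tendsto 0).mono_left (nhdsWithin_le_nhds (s := Set.Ioi 0))
    simpa using this
  exact ge_of_tendsto hlim (eventually_mem_nhdsWithin.mono fun ε hε => h ε hε)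

theorem mainTheorem6 {κ : ℕ} (hκ : 1 ≤ κ) (T : Set (Fin κ → ℤ)) (hT0 : (0 : Fin κ → ℤ) ∈ T)
    (hT : T = -T) (Y : Set (Torus κ)) (hY : IsDeterminingAnalytic Y) (c : T → ℂ) :
    List.TFAE [
      (∃ μ : Measure (Torus κ), IsFiniteMeasure μ ∧
        ∀ α : T, c α = ∫ z, torusMonomial (α : Fin κ → ℤ) z ∂μ),
      (∀ a : T →₀ ℂ,
        (∀ z : Torus κ, 0 ≤ a.sum fun α b => b * torusMonomial (α : Fin κ → ℤ) z) →
        0 ≤ a.sum fun α b => b * c α),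
      (∀ a : T →₀ ℂ,
        (∃ (k : ℕ) (q : Fin k → Torus κ → ℂ), (∀ j, q j ∈ analyticTrigPoly κ) ∧
          ∀ z ∈ Y, (a.sum fun α b => b * torusMonomial (α : Fin κ → ℤ) z) =
            ∑ j, ((‖q j z‖ ^ 2 : ℝ) : ℂ)) →
        0 ≤ a.sum fun α b => b * c α)] := by
  tfae_have 1 → 2 := by
    rintro ⟨μ, hμ, hc⟩ a ha
    exact finsuppSum_nonneg_of_moments μ hc a ha
  tfae_have 2 → 3 := by
    rintro h a ⟨k, q, hq, hqY⟩
    refine h a fun z => ?_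
    rw [hY.eq_sum_sq_norm (trigPoly_mono (Set.subset_univ T)
      (finsuppSum_torusMonomial_mem_trigPoly a)) hq hqY z, ← Complex.ofReal_sum]
    exact Complex.zero_le_real.2 (Finset.sum_nonneg fun j _ => sq_nonneg _)
  tfae_have 3 → 1 := by
    intro h
    refine exists_measure_of_nonneg hT0 hT fun a ha => ?_
    -- Adding the constant ε, available because 0 ∈ T, makes the polynomial strictly positive and
    -- changes the functional by ε c_0.
    refine nonneg_of_forall_pos_mul_add_nonneg (u := c ⟨0, hT0⟩) fun ε hε => ?_
    obtain ⟨k, q, hq, hqz⟩ := exists_sum_sq_norm_of_pos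
      (a + Finsupp.single ⟨0, hT0⟩ (ε : ℂ)) fun z => by
        rw [map_add, finsuppTrigPoly_single, torusMonomial_zero, mul_one]
        exact add_pos_of_nonneg_of_pos (ha z) (Complex.zero_lt_real.2 hε)
    have h2 : 0 ≤ Finsupp.linearCombination ℂ c (a + Finsupp.single ⟨0, hT0⟩ (ε : ℂ)) :=
      h _ ⟨k, q, hq, fun z _ => hqz z⟩
    simpa using h2
  tfae_finish
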